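/- Let $k\ge 3$ and $X=\{0,\dots,k-1\}$. The words over $X$, ordered by the prefix relation, form the $k$-regular rooted tree. For $0\le i<j\le k-1$ let $a_{(ij)}$ be the tree automorphism given recursively by $$a_{(ij)}(iw)=jw,\qquad a_{(ij)}(jw)=iw,\qquad a_{(ij)}(xw)=x\,a_{(ij)}(w)\quad (x\in X\setminus\{i,j\}),$$ for all words $w$ over $X$. The Hanoi Towers group $H^{(k)}$ on $k$ pegs is the group of tree automorphisms generated by the set $S$ of all $a_{(ij)}$, $0\le i<j\le k-1$. For an infinite word $\xi$ over $X$, let $\xi_n$ be its prefix of length $n$, let $P_n$ be the stabilizer of $\xi_n$ in $H^{(k)}$, and let $\Gamma_n$ be the Schreier graph of $H^{(k)}$ with respect to $P_n$ and $S$: its vertices are the cosets $gP_n$, and $gP_n$ is joined to $sgP_n$ for every $s\in S$. (This is the graph of the action of $H^{(k)}$ on the words of length $n$.) For functions $f,g$ from the non-negative integers to $\mathbb{R}$ write $f\preceq g$ if there is a positive integer $C$ such that $f(n)\le g(Cn)$ for all $n\ge 1$, and $f\sim g$ if $f\preceq g$ and $g\preceq f$. **Theorem.** For every $k\ge 3$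 and every $n\ge 0$ the diameter $d(n)$ of $\Gamma_n$ is finite and does not depend on $\xi$, and $$d(n)\sim e^{\,n^{1/(k-2)}}.$$ If $k\ge 4$, then $d(n)$ has intermediate growth, that is, $\lim_{n\to\infty}\sqrt[n]{d(n)}=1$, and $n^m\preceq d(n)$ for every real $m>0$. -/

import Mathlib

/-- The group of automorphisms of the `k`-regular rooted tree: the vertices are the finite words over
`{0, …, k-1}`, ordered by the prefix relation, and an automorphism is a bijection of the set of words
that preserves and reflects this relation. -/
abbrev TreeAut (k : ℕ) : Type :=
  (List.IsPrefix : List (Fin k) → List (Fin k) → Prop) ≃r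
    (List.IsPrefix : List (Fin k) → List (Fin k) → Prop)

/-- Tree automorphisms act on words by evaluation. -/
instance TreeAut.instMulAction (k : ℕ) : MulAction (TreeAut k) (List (Fin k)) where
  smul g w := g w
  one_smul _ := rfl
  mul_smul _ _ _ := rfl

/-- The action on words of `a_π = π (a_0, …, a_{k-1})`, where the section `a_x` is the identity if `x` is
in the support of `π`, and is `a_π` itself if `π` fixes `x`. -/
def permWordMap {k : ℕ} (π : Equiv.Perm (Fin k)) : List (Fin k) → List (Fin k)
  | [] => []
  | x :: w => π x :: (if π x = x then permWordMap π w else w)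

theorem permWordMap_leftInverse {k : ℕ} (π ρ : Equiv.Perm (Fin k)) (h : ∀ x, ρ (π x) = x)
    (w : List (Fin k)) : permWordMap ρ (permWordMap π w) = w := by
  induction w with
  | nil => rfl
  | cons x w ih =>
    have hx := h x
    by_cases hπ : π x = x
    · rw [hπ] at hx
      simp [permWordMap, hπ, hx, ih]
    · have : ¬ x = π x := fun e => hπ e.symm
      simp [permWordMap, hπ, hx, this]

theorem permWordMap_prefix {k : ℕ} (π : Equiv.Perm (Fin k)) {u v : List (Fin k)} (h : u <+: v) :
    permWordMap π u <+: permWordMap π v := by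
  induction u generalizing v with
  | nil => exact List.nil_prefix
  | cons x u ih =>
    cases v with
    | nil => simp at h
    | cons y v =>
      obtain ⟨rfl, h'⟩ := List.cons_prefix_cons.1 h
      by_cases hπ : π x = x
      · simp [permWordMap, hπ, List.cons_prefix_cons, ih h']
      · simp [permWordMap, hπ, List.cons_prefix_cons, h']

/-- The tree automorphism `a_π`. -/
def permAut {k : ℕ} (π : Equiv.Perm (Fin k)) : TreeAut k where
  toFun := permWordMap π
  invFun := permWordMap π⁻¹
  left_inv := permWordMap_leftInverse π π⁻¹ (by simp)
  right_inv := permWordMap_leftInverse π⁻¹ π (by simp)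
  map_rel_iff' := by
    intro u v
    refine ⟨fun h => ?_, fun h => permWordMap_prefix π h⟩
    have h' := permWordMap_prefix π⁻¹ h
    simpa [permWordMap_leftInverse π π⁻¹ (by simp)] using h'

/-- The generators `a_{(i j)}`, `i < j`, of the Hanoi Towers group. -/
def hanoiGenerators (k : ℕ) : Set (TreeAut k) :=
  {g | ∃ i j : Fin k, i < j ∧ g = permAut (Equiv.swap i j)}

/-- The Hanoi Towers group on `k` pegs. -/
def hanoiGroup (k : ℕ) : Subgroup (TreeAut k) :=
  Subgroup.closure (hanoiGenerators k)

/-- The Schreier graph `Γ(G, P, S)`: the vertices are the cosets `g P`, and `g P` is joined to `s g P` for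
`s ∈ S`. It is recorded as a simple graph (loops, multiplicities and labels of edges are dropped), which
does not affect distances. -/
def schreierGraph {G : Type*} [Group G] (P : Subgroup G) (S : Set G) : SimpleGraph (G ⧸ P) :=
  SimpleGraph.fromRel fun u v => ∃ s ∈ S, s • u = v

/-- The prefix of length `n` of an infinite word `ξ`. -/
def rayPrefix {k : ℕ} (ξ : ℕ → Fin k) (n : ℕ) : List (Fin k) :=
  (List.range n).map ξ

/-- The stabilizer `P_n` in the Hanoi Towers group of the vertex `ξ_n` of the tree. -/
def hanoiStabilizer {k : ℕ} (ξ : ℕ → Fin k) (n : ℕ) : Subgroup (hanoiGroup k) :=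
  MulAction.stabilizer (hanoiGroup k) (rayPrefix ξ n)

/-- The level-`n` Schreier graph `Γ_n` of the Hanoi Towers group along the ray `ξ`. -/
def hanoiSchreierGraph {k : ℕ} (ξ : ℕ → Fin k) (n : ℕ) :
    SimpleGraph (hanoiGroup k ⧸ hanoiStabilizer ξ n) :=
  schreierGraph (hanoiStabilizer ξ n) {s | (s : TreeAut k) ∈ hanoiGenerators k}

/-- `f ⪯ g`: for some positive integer `C`, `f n ≤ g (C n)` for all `n ≥ 1`. -/
def GrowthLE (f g : ℕ → ℝ) : Prop :=
  ∃ C : ℕ, 0 < C ∧ ∀ n : ℕ, 1 ≤ n → f n ≤ g (C * n)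

/-- `f ∼ g`: `f ⪯ g` and `g ⪯ f`. -/
def GrowthEquiv (f g : ℕ → ℝ) : Prop :=
  GrowthLE f g ∧ GrowthLE g f

/-- Intermediate growth: the `n`-th root of `f n` tends to `1`, and `n ^ m ⪯ f` for all `m > 0`. -/
def IntermediateGrowth (f : ℕ → ℝ) : Prop :=
  Filter.Tendsto (fun n : ℕ => f n ^ (1 / (n : ℝ))) Filter.atTop (nhds 1) ∧
    ∀ m : ℝ, 0 < m → GrowthLE (fun n : ℕ => (n : ℝ) ^ m) f

/-! Write `k = s + 2`. A word of length `n` is a configuration of `n` disks, smallest first, and a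
generator moves the smallest disk found on two given pegs. So the distances in the Schreier graph
count moves, and both bounds on the diameter concern the Hanoi game.

Upper bound (Frame–Stewart, `hanoiReach_of_length_le`): split the disks into small ones, moved with
all pegs, and large ones, moved while the small ones block one peg. The disk counts obey Pascal's
rule for `Nat.multichoose j s`, which is at least `j ^ s / s!`, while each increment of `j` costs a
factor 8. Hence `n` disks need at most `8 ^ O(n ^ (1 / s))` moves.

Lower bound (Szegedy, `add_two_pow_le_of_moves`): if all of about `j ^ s` disks must move, either
the smallest of them all move in each of two disjoint time intervals, which doubles the cost, or one
of them rests while many larger disks move, which costs these a peg. Moving all disks from one peg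
to another thus needs `exp (c * n ^ (1 / s))` moves.

Constants in the exponent are absorbed by the rescaling `n ↦ C * n` in `GrowthLE`. -/

/-! ### Lower bound for abstract sequences of moves -/

/-- A sequence step in which at most one disk changes its peg, and a disk that changes its peg neither
leaves nor enters a peg that holds a smaller disk. -/
def HanoiStep {P : Type*} (c c' : ℕ → P) : Prop :=
  ∀ d, c d ≠ c' d → (∀ e, e ≠ d → c e = c' e) ∧ ∀ e < d, c e ≠ c d ∧ c e ≠ c' d

/-- The disk `d` changes its peg at some time of the interval `[a, b)`. -/
def Moves {P : Type*} (c : ℕ → ℕ → P) (a b d : ℕ) : Prop :=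
  ∃ t, a ≤ t ∧ t < b ∧ c t d ≠ c (t + 1) d

/-- Greedy choice of minima; it splits off the smallest disks in the lower bound. -/
theorem exists_initial_subset (A : Finset ℕ) (n : ℕ) (hn : n ≤ A.card) :
    ∃ S ⊆ A, S.card = n ∧ ∀ x ∈ S, ∀ y ∈ A \ S, x < y := by
  induction n with
  | zero => exact ⟨∅, by simp, by simp, by simp⟩
  | succ n ih =>
    obtain ⟨S, hSA, hS, hlt⟩ := ih (by omega)
    have hne : (A \ S).Nonempty := by
      rw [← Finset.card_pos, Finset.card_sdiff_of_subset hSA]; omega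
    set m := (A \ S).min' hne with hm
    have hmem : m ∈ A \ S := Finset.min'_mem _ _
    obtain ⟨hmA, hmS⟩ := Finset.mem_sdiff.1 hmem
    refine ⟨insert m S, ?_, by rw [Finset.card_insert_of_notMem hmS, hS], ?_⟩
    · intro x hx
      rcases Finset.mem_insert.1 hx with rfl | hx
      exacts [hmA, hSA hx]
    · intro x hx y hy
      obtain ⟨hyA, hyS⟩ := Finset.mem_sdiff.1 hy
      have hyS' : y ∉ S := fun h => hyS (Finset.mem_insert_of_mem h)
      have hyd : y ∈ A \ S := Finset.mem_sdiff.2 ⟨hyA, hyS'⟩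
      rcases Finset.mem_insert.1 hx with rfl | hx
      · refine lt_of_le_of_ne (Finset.min'_le _ _ hyd) ?_
        intro h
        exact hyS (h ▸ Finset.mem_insert_self _ _)
      · exact hlt x hx y hyd

theorem eq_of_not_moves {P : Type*} {c : ℕ → ℕ → P} {a b d : ℕ} (h : ¬ Moves c a b d) {t : ℕ}
    (hat : a ≤ t) (htb : t ≤ b) : c t d = c a d := by
  induction t, hat using Nat.le_induction with
  | base => rfl
  | succ t hat ih =>
    rw [← ih (by omega)]
    by_contra hne
    exact h ⟨t, hat, by omega, fun e => hne e.symm⟩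

/-- While a smaller disk stands still, a disk that moves never visits the peg of the smaller disk. -/
theorem ne_of_not_moves_of_moves {P : Type*} {c : ℕ → ℕ → P}
    (hc : ∀ t, HanoiStep (c t) (c (t + 1))) {a b y d : ℕ} (hyd : y < d) (hy : ¬ Moves c a b y)
    (hd : Moves c a b d) {t : ℕ} (hat : a ≤ t) (htb : t ≤ b) : c t d ≠ c a y := by
  -- Being on the peg of `y` is invariant in time, and a disk that is always there cannot move.
  have key : ∀ t, a ≤ t → t < b → (c t d = c a y ↔ c (t + 1) d = c a y) := by
    intro t hat htb
    by_cases h : c t d = c (t + 1) d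
    · rw [h]
    · have := (hc t d h).2 y hyd
      rw [eq_of_not_moves hy hat htb.le] at this
      exact ⟨fun e => absurd e.symm this.1, fun e => absurd e.symm this.2⟩
  have key' : ∀ t, a ≤ t → t ≤ b → (c t d = c a y ↔ c a d = c a y) := by
    intro t hat
    induction t, hat using Nat.le_induction with
    | base => simp
    | succ t hat ih => intro htb; rw [← key t hat (by omega), ih (by omega)]
  obtain ⟨u, hau, hub, hu⟩ := hd
  intro h
  have h0 := (key' t hat htb).1 h
  exact hu (((key' u hau hub.le).2 h0).trans ((key' (u + 1) (by omega) hub).2 h0).symm)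

/-- Szegedy's lower bound: if all disks of `A` move and stay on a set of `s + 2` pegs, then the number of
moves is at least `2 ^ j` as soon as `A` has `2 ^ (s + 1) * (j + 1) ^ s` disks. -/
theorem add_two_pow_le_of_moves {P : Type*} [DecidableEq P] {c : ℕ → ℕ → P}
    (hc : ∀ t, HanoiStep (c t) (c (t + 1))) (s : ℕ) : ∀ (j : ℕ) (Q : Finset P) (A : Finset ℕ)
    (a b : ℕ), Q.card = s + 2 → (∀ d ∈ A, ∀ t, a ≤ t → t ≤ b → c t d ∈ Q) →
    (∀ d ∈ A, Moves c a b d) → 2 ^ (s + 1) * (j + 1) ^ s ≤ A.card → a + 2 ^ j ≤ b := by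
  induction s with
  | zero =>
    intro j Q A a b hQ hAQ hA hcard
    exfalso
    obtain ⟨x, hx, y, hy, hxy⟩ := Finset.one_lt_card.1 (show 1 < A.card by simp at hcard; omega)
    wlog hlt : x < y generalizing x y
    · exact this y hy x hx hxy.symm (by omega)
    obtain ⟨t, hat, htb, ht⟩ := hA y hy
    have h := (hc t y ht).2 x hlt
    -- The peg of `x` and the two ends of the move of `y` are three distinct pegs in a set of two.
    have hsub : ({c t x, c t y, c (t + 1) y} : Finset P) ⊆ Q := by
      intro p hp
      simp only [Finset.mem_insert, Finset.mem_singleton] at hp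
      rcases hp with rfl | rfl | rfl
      exacts [hAQ x hx t hat htb.le, hAQ y hy t hat htb.le, hAQ y hy _ (by omega) htb]
    have := Finset.card_le_card hsub
    rw [Finset.card_eq_three.2 ⟨_, _, _, h.1, h.2, ht, rfl⟩] at this
    omega
  | succ s ihs =>
    intro j
    induction j with
    | zero =>
      intro Q A a b hQ hAQ hA hcard
      have : 0 < A.card := lt_of_lt_of_le (by positivity) hcard
      obtain ⟨x, hx⟩ := Finset.card_pos.1 this
      obtain ⟨t, hat, htb, -⟩ := hA x hx
      simp; omega
    | succ j ihj =>
      intro Q A a b hQ hAQ hA hcard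
      -- `N` disks suffice for `ihj`, and `M` disks with one peg fewer suffice for `ihs` at `j + 1`.
      set N := 2 ^ (s + 1 + 1) * (j + 1) ^ (s + 1) with hN
      set M := 2 ^ (s + 1) * (j + 1 + 1) ^ s with hM
      have hNM : N + 2 * M ≤ A.card := by
        refine le_trans ?_ hcard
        have h1 : (j + 1) ^ s ≤ (j + 1 + 1) ^ s := Nat.pow_le_pow_left (by omega) _
        calc N + 2 * M = 2 ^ (s + 1 + 1) * ((j + 1) ^ s * (j + 1) + (j + 1 + 1) ^ s) := by
              rw [hN, hM]; ring
          _ ≤ 2 ^ (s + 1 + 1) * ((j + 1 + 1) ^ s * (j + 1) + (j + 1 + 1) ^ s) := by gcongr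
          _ = _ := by ring
      have hNpos : 0 < N := by positivity
      obtain ⟨S, hSA, hScard, hlt⟩ := exists_initial_subset A N (by omega)
      -- A resting disk of `S` takes its peg away from all larger disks that move meanwhile.
      have narrow : ∀ (y a' b' : ℕ) (B : Finset ℕ), a ≤ a' → b' ≤ b → a' ≤ b' → y ∈ S →
          ¬ Moves c a' b' y → B ⊆ A \ S → (∀ d ∈ B, Moves c a' b' d) → M ≤ B.card →
          a' + 2 ^ (j + 1) ≤ b' := by
        intro y a' b' B ha hb hab hyS hy hB hmv hMB
        refine ihs (j + 1) (Q.erase (c a' y)) B a' b' ?_ ?_ hmv hMB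
        · rw [Finset.card_erase_of_mem (hAQ y (hSA hyS) a' ha (hab.trans hb)), hQ]; omega
        · intro d hd t hat htb
          refine Finset.mem_erase.2 ⟨ne_of_not_moves_of_moves hc (hlt y hyS d (hB hd)) hy
            (hmv d hd) hat htb, ?_⟩
          exact hAQ d (Finset.mem_sdiff.1 (hB hd)).1 t (ha.trans hat) (htb.trans hb)
      classical
      have hex : ∃ t, ∀ x ∈ S, Moves c a t x := ⟨b, fun x hx => hA x (hSA hx)⟩
      -- `t` is the first time by which all of `S` has moved; the disk `y` below moves first at `t -
      -- 1`, so it rests during `[a, t - 1)`.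
      set t := Nat.find hex with ht
      have htS : ∀ x ∈ S, Moves c a t x := Nat.find_spec hex
      have htb : t ≤ b := Nat.find_min' hex fun x hx => hA x (hSA hx)
      obtain ⟨x₀, hx₀⟩ := Finset.card_pos.1 (hScard.symm ▸ hNpos : 0 < S.card)
      have hta : a < t := by
        obtain ⟨u, h1, h2, -⟩ := htS x₀ hx₀; omega
      have hlast := Nat.find_min hex (m := t - 1) (by omega)
      push Not at hlast
      obtain ⟨y, hyS, hy⟩ := hlast
      have hytop : c (t - 1) y ≠ c (t - 1 + 1) y := by
        obtain ⟨u, h1, h2, h3⟩ := htS y hyS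
        have : u = t - 1 := by
          by_contra hne
          exact hy ⟨u, h1, by omega, h3⟩
        rwa [this] at h3
      by_cases hall : ∀ x ∈ S, Moves c t b x
      · have h1 := ihj Q S a t hQ (fun d hd u hu hu' => hAQ d (hSA hd) u hu (hu'.trans htb)) htS
          hScard.ge
        have h2 := ihj Q S t b hQ (fun d hd u hu hu' => hAQ d (hSA hd) u (hta.le.trans hu) hu')
          hall hScard.ge
        rw [pow_succ]; omega
      · push Not at hall
        obtain ⟨x, hxS, hx⟩ := hall
        -- Only `y` moves at `t - 1`, so each larger disk moves while `y` rests or while `x` rests;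
        -- by pigeonhole one interval has `M` such disks.
        have hcover : A \ S ⊆ (A \ S).filter (Moves c a (t - 1)) ∪ (A \ S).filter (Moves c t b) := by
          intro d hd
          have hdS := (Finset.mem_sdiff.1 hd).2
          obtain ⟨u, h1, h2, h3⟩ := hA d (Finset.mem_sdiff.1 hd).1
          simp only [Finset.mem_union, Finset.mem_filter, hd, true_and]
          rcases lt_trichotomy u (t - 1) with hu | hu | hu
          · exact Or.inl ⟨u, h1, hu, h3⟩
          · subst hu
            exact absurd ((hc _ y hytop).1 d fun e => hdS (e ▸ hyS)) h3
          · exact Or.inr ⟨u, by omega, h2, h3⟩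
        have hle := (Finset.card_le_card hcover).trans (Finset.card_union_le _ _)
        rw [Finset.card_sdiff_of_subset hSA, hScard] at hle
        rcases le_or_gt M ((A \ S).filter (Moves c a (t - 1))).card with h | h
        · have := narrow y a (t - 1) _ le_rfl (by omega) (by omega) hyS hy (Finset.filter_subset _ _)
            (fun d hd => (Finset.mem_filter.1 hd).2) h
          omega
        · have := narrow x t b ((A \ S).filter (Moves c t b)) hta.le le_rfl htb hxS hx
            (Finset.filter_subset _ _) (fun d hd => (Finset.mem_filter.1 hd).2) (by omega)
          omega

/-! ### Sequences of moves on words -/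

/-- The word `v` arises from `u` by at most `L` moves between pegs of `Q`. -/
inductive HanoiReach {k : ℕ} (Q : Finset (Fin k)) : ℕ → List (Fin k) → List (Fin k) → Prop
  | refl (L : ℕ) (u : List (Fin k)) : HanoiReach Q L u u
  | tail {L : ℕ} {u v : List (Fin k)} (i j : Fin k) (hi : i ∈ Q) (hj : j ∈ Q) (hij : i ≠ j)
      (h : HanoiReach Q L u v) : HanoiReach Q (L + 1) u (permWordMap (Equiv.swap i j) v)

namespace HanoiReach

variable {k : ℕ} {Q : Finset (Fin k)}

theorem mono {L M : ℕ} {u v : List (Fin k)} (h : HanoiReach Q L u v) (hLM : L ≤ M) :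
    HanoiReach Q M u v := by
  induction h generalizing M with
  | refl => exact refl _ _
  | tail i j hi hj hij _ ih =>
    obtain ⟨M, rfl⟩ : ∃ N, M = N + 1 := ⟨M - 1, by omega⟩
    exact tail i j hi hj hij (ih (by omega))

theorem trans {L M : ℕ} {u v w : List (Fin k)} (h : HanoiReach Q L u v) (h' : HanoiReach Q M v w) :
    HanoiReach Q (L + M) u w := by
  induction h' with
  | refl => exact h.mono (by omega)
  | tail i j hi hj hij _ ih => exact tail i j hi hj hij (ih h)

theorem symm {L : ℕ} {u v : List (Fin k)} (h : HanoiReach Q L u v) : HanoiReach Q L v u := by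
  induction h with
  | refl => exact refl _ _
  | @tail L u v i j hi hj hij _ ih =>
    have h1 : HanoiReach Q 1 (permWordMap (Equiv.swap i j) v) v := by
      have := tail i j hi hj hij (refl (Q := Q) 0 (permWordMap (Equiv.swap i j) v))
      rwa [permWordMap_leftInverse _ _ (by simp)] at this
    exact (h1.trans ih).mono (by omega)

end HanoiReach

theorem permWordMap_append_of_fixed {k : ℕ} {π : Equiv.Perm (Fin k)} {u : List (Fin k)}
    (hu : ∀ x ∈ u, π x = x) (v : List (Fin k)) :
    permWordMap π (u ++ v) = u ++ permWordMap π v := by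
  induction u with
  | nil => rfl
  | cons x u ih =>
    simp [permWordMap, hu x (by simp), ih fun y hy => hu y (by simp [hy])]

theorem permWordMap_eq_self_of_fixed {k : ℕ} {π : Equiv.Perm (Fin k)} {u : List (Fin k)}
    (hu : ∀ x ∈ u, π x = x) : permWordMap π u = u := by
  simpa [permWordMap] using permWordMap_append_of_fixed hu []

theorem permWordMap_append_of_moved {k : ℕ} {π : Equiv.Perm (Fin k)} {u : List (Fin k)}
    (hu : ∃ x ∈ u, π x ≠ x) (v : List (Fin k)) :
    permWordMap π (u ++ v) = permWordMap π u ++ v := by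
  induction u with
  | nil => simp at hu
  | cons x u ih =>
    by_cases hx : π x = x
    · have : ∃ x ∈ u, π x ≠ x := by
        obtain ⟨y, hy, hy'⟩ := hu
        rcases List.mem_cons.1 hy with rfl | hy
        exacts [absurd hx hy', ⟨y, hy, hy'⟩]
      simp [permWordMap, hx, ih this]
    · simp [permWordMap, hx]

theorem length_permWordMap {k : ℕ} (π : Equiv.Perm (Fin k)) (u : List (Fin k)) :
    (permWordMap π u).length = u.length := by
  induction u with
  | nil => rfl
  | cons x u ih => simp only [permWordMap, List.length_cons]; split <;> simp [ih]

namespace HanoiReach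

variable {k : ℕ} {Q : Finset (Fin k)}

theorem append_right {L : ℕ} {u v : List (Fin k)} (h : HanoiReach Q L u v) (w : List (Fin k)) :
    HanoiReach Q L (u ++ w) (v ++ w) := by
  induction h with
  | refl => exact refl _ _
  | @tail L u v i j hi hj hij _ ih =>
    by_cases hv : ∃ x ∈ v, Equiv.swap i j x ≠ x
    · rw [← permWordMap_append_of_moved hv]
      exact tail i j hi hj hij ih
    -- A move idle on `v` could move a disk of `w`, so it is dropped.
    · push Not at hv
      rw [permWordMap_eq_self_of_fixed hv]
      exact ih.mono (by omega)

/-- Smaller disks on pegs outside `R` do not obstruct moves between pegs of `R`. -/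
theorem append_left {L : ℕ} {R : Finset (Fin k)} {u v w : List (Fin k)} (h : HanoiReach R L u v)
    (hRQ : R ⊆ Q) (hw : ∀ x ∈ w, x ∉ R) : HanoiReach Q L (w ++ u) (w ++ v) := by
  induction h with
  | refl => exact refl _ _
  | @tail L u v i j hi hj hij _ ih =>
    rw [← permWordMap_append_of_fixed (u := w)]
    · exact tail i j (hRQ hi) (hRQ hj) hij ih
    · intro x hx
      exact Equiv.swap_apply_of_ne_of_ne (fun e => hw x hx (e ▸ hi)) (fun e => hw x hx (e ▸ hj))

end HanoiReach

/-! ### The Frame–Stewart upper bound -/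

/-- Two words agree outside the pegs of `Q`. -/
def AgreeOutside {k : ℕ} (Q : Finset (Fin k)) (u v : List (Fin k)) : Prop :=
  List.Forall₂ (fun a b => a = b ∨ (a ∈ Q ∧ b ∈ Q)) u v

/-- Put all disks on the pegs of `Q` on the peg `p`. -/
def gather {k : ℕ} (Q : Finset (Fin k)) (p : Fin k) (u : List (Fin k)) : List (Fin k) :=
  u.map fun a => if a ∈ Q then p else a

section gather

variable {k : ℕ} {Q : Finset (Fin k)}

theorem length_gather (p : Fin k) (u : List (Fin k)) : (gather Q p u).length = u.length := by
  simp [gather]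

theorem agreeOutside_map {f g : Fin k → Fin k} (h : ∀ a, f a = g a ∨ (f a ∈ Q ∧ g a ∈ Q))
    (u : List (Fin k)) : AgreeOutside Q (u.map f) (u.map g) := by
  induction u with
  | nil => exact List.Forall₂.nil
  | cons x u ih => exact List.Forall₂.cons (h x) ih

theorem agreeOutside_gather {p : Fin k} (hp : p ∈ Q) (u : List (Fin k)) :
    AgreeOutside Q u (gather Q p u) := by
  have := agreeOutside_map (Q := Q) (f := id) (g := fun a => if a ∈ Q then p else a)
    (fun a => by by_cases h : a ∈ Q <;> simp [h, hp]) u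
  simpa [gather] using this

theorem AgreeOutside.gather_eq {p : Fin k} {u v : List (Fin k)} (h : AgreeOutside Q u v) :
    gather Q p u = gather Q p v := by
  induction h with
  | nil => rfl
  | cons h _ ih =>
    rcases h with rfl | ⟨h1, h2⟩
    · simpa [gather] using ih
    · simpa [gather, h1, h2] using ih

theorem notMem_erase_of_mem_gather {p : Fin k} {u : List (Fin k)} {x : Fin k}
    (hx : x ∈ gather Q p u) : x ∉ Q.erase p := by
  obtain ⟨a, -, rfl⟩ := List.mem_map.1 hx
  by_cases h : a ∈ Q <;> simp [h]

/-- Collecting the small disks `u` and the large disks `v` on two different pegs: the large disks are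
moved twice, each time avoiding a peg that holds the small disks. -/
theorem hanoiReach_gather {p q r : Fin k} (hp : p ∈ Q) (hq : q ∈ Q) (hr : r ∈ Q) (hpq : p ≠ q)
    (hpr : p ≠ r) (hqr : q ≠ r) {D E n m : ℕ}
    (hD : ∀ u u' : List (Fin k), u.length ≤ n → AgreeOutside Q u u' → HanoiReach Q D u u')
    (hE : ∀ x ∈ Q, ∀ v v' : List (Fin k), v.length ≤ m → AgreeOutside (Q.erase x) v v' →
      HanoiReach (Q.erase x) E v v')
    {u v : List (Fin k)} (hu : u.length ≤ n) (hv : v.length ≤ m) :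
    HanoiReach Q (2 * D + 2 * E) (u ++ v) (gather Q r u ++ gather Q q v) := by
  have hq' : q ∈ Q.erase p := Finset.mem_erase.2 ⟨hpq.symm, hq⟩
  -- Large disks already on `p` are blocked by the small ones and stay there until the second round.
  set v₁ := gather (Q.erase p) q v with hv₁
  have s1 := (hD u (gather Q p u) hu (agreeOutside_gather hp u)).append_right v
  have s2 := (hE p hp v v₁ hv (agreeOutside_gather hq' v)).append_left (w := gather Q p u)
    (Finset.erase_subset _ _) (fun x hx => notMem_erase_of_mem_gather hx)
  have hag : AgreeOutside Q (gather Q p u) (gather Q r u) :=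
    agreeOutside_map (fun a => by by_cases h : a ∈ Q <;> simp [h, hp, hr]) u
  have s3 := (hD (gather Q p u) (gather Q r u) (by rwa [length_gather]) hag).append_right v₁
  have hag' : AgreeOutside (Q.erase r) v₁ (gather Q q v) := by
    refine agreeOutside_map (fun a => ?_) v
    by_cases h : a ∈ Q
    · by_cases h' : a = p
      · subst h'; simp [h, hpr, hq, hqr]
      · simp [h, h']
    · simp [h]
  have s4 := (hE r hr v₁ (gather Q q v) (by rwa [hv₁, length_gather]) hag').append_left
    (w := gather Q r u) (Finset.erase_subset _ _) (fun x hx => notMem_erase_of_mem_gather hx)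
  exact (((s1.trans s2).trans s3).trans s4).mono (by omega)

end gather

/-- The upper bound of Frame and Stewart, for arbitrary pairs of configurations. -/
theorem hanoiReach_of_length_le {k : ℕ} (s : ℕ) : ∀ (j : ℕ) (Q : Finset (Fin k)),
    Q.card = s + 2 → ∀ w w' : List (Fin k), w.length ≤ Nat.multichoose j s → AgreeOutside Q w w' →
      HanoiReach Q (8 ^ (j + s + 1)) w w' := by
  induction s with
  | zero =>
    intro j Q hQ w w' hw h
    rw [Nat.multichoose_zero_right] at hw
    cases h with
    | nil => exact .refl _ _
    | @cons a b l l' hab hl =>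
      obtain rfl : l = [] := by
        simpa using hw
      cases hl
      by_cases e : a = b
      · subst e; exact .refl _ _
      · obtain ⟨ha, hb⟩ := hab.resolve_left e
        have := HanoiReach.tail a b ha hb e (.refl (Q := Q) 0 [a])
        rw [show permWordMap (Equiv.swap a b) [a] = [b] by simp [permWordMap]] at this
        exact this.mono (Nat.one_le_pow _ _ (by norm_num))
  | succ s ihs =>
    intro j
    induction j with
    | zero =>
      intro Q hQ w w' hw h
      rw [Nat.multichoose_zero_succ, Nat.le_zero, List.length_eq_zero_iff] at hw
      subst hw
      cases h
      exact .refl _ _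
    | succ j ihj =>
      intro Q hQ w w' hw h
      obtain ⟨p, q, r, hp, hq, hr, hpq, hpr, hqr⟩ :=
        Finset.two_lt_card_iff.1 (show 2 < Q.card by omega)
      -- Pascal's rule: `n` small disks use all pegs, `m` large ones use one peg fewer.
      set n := Nat.multichoose j (s + 1) with hn
      set m := Nat.multichoose (j + 1) s with hm
      rw [Nat.multichoose_succ_succ] at hw
      have key : ∀ w : List (Fin k), w.length ≤ n + m → HanoiReach Q
          (2 * 8 ^ (j + (s + 1) + 1) + 2 * 8 ^ (j + 1 + s + 1)) w
          (gather Q r (w.take n) ++ gather Q q (w.drop n)) := by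
        intro w hw
        have := hanoiReach_gather hp hq hr hpq hpr hqr (n := n) (m := m)
          (fun u u' hu hag => ihj Q hQ u u' hu hag)
          (fun x hx v v' hv hag => ihs (j + 1) (Q.erase x)
            (by rw [Finset.card_erase_of_mem hx, hQ]; omega) v v' hv hag)
          (u := w.take n) (v := w.drop n) (by simp) (by simp; omega)
        rwa [List.take_append_drop] at this
      -- Gathering forgets positions inside `Q`, so both words lead to one configuration.
      have e : gather Q r (w.take n) ++ gather Q q (w.drop n)
          = gather Q r (w'.take n) ++ gather Q q (w'.drop n) := by
        rw [AgreeOutside.gather_eq (u := w.take n) (v := w'.take n) (List.forall₂_take n h),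
          AgreeOutside.gather_eq (u := w.drop n) (v := w'.drop n) (List.forall₂_drop n h)]
      have h1 := key w (by omega)
      have h2 := key w' (by rw [← h.length_eq]; omega)
      rw [e] at h1
      -- Two gatherings of four stages each, all of the same cost, give the factor 8.
      refine (h1.trans h2.symm).mono (le_of_eq ?_)
      ring

/-! ### Words as positions of disks -/

theorem HanoiReach.exists_seq {k : ℕ} {Q : Finset (Fin k)} {L : ℕ} {u v : List (Fin k)}
    (h : HanoiReach Q L u v) : ∃ f : ℕ → List (Fin k), f 0 = u ∧ f L = v ∧
      ∀ t, f (t + 1) = f t ∨ ∃ π : Equiv.Perm (Fin k), f (t + 1) = permWordMap π (f t) := by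
  induction h with
  | refl L u => exact ⟨fun _ => u, rfl, rfl, fun _ => Or.inl rfl⟩
  | @tail L u v i j hi hj hij _ ih =>
    obtain ⟨f, h0, hL, hf⟩ := ih
    refine ⟨fun t => if t ≤ L then f t else permWordMap (Equiv.swap i j) v, by simp [h0],
      by simp, fun t => ?_⟩
    rcases lt_trichotomy t L with ht | rfl | ht
    · simpa [ht.le, Nat.succ_le_of_lt ht] using hf t
    · exact Or.inr ⟨Equiv.swap i j, by simp [hL]⟩
    · exact Or.inl (by simp [ht.not_ge, (Nat.lt_succ_of_lt ht).not_ge])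

theorem getElem?_permWordMap {k : ℕ} (π : Equiv.Perm (Fin k)) (w : List (Fin k)) (d : ℕ) :
    (permWordMap π w)[d]? = w[d]? ∨
      ∃ y, w[d]? = some y ∧ (permWordMap π w)[d]? = some (π y) := by
  induction w generalizing d with
  | nil => exact Or.inl rfl
  | cons x w ih =>
    cases d with
    | zero => exact Or.inr ⟨x, by simp, by simp [permWordMap]⟩
    | succ d =>
      by_cases hx : π x = x
      · simpa [permWordMap, hx] using ih d
      · simp [permWordMap, hx]

/-- Only the first letter not fixed by `π` changes. Smaller disks sit on fixed points of `π`,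
whereas the old and new pegs are both moved by `π`. -/
theorem hanoiStep_permWordMap {k : ℕ} (π : Equiv.Perm (Fin k)) (w : List (Fin k)) :
    HanoiStep (fun d => w[d]?) (fun d => (permWordMap π w)[d]?) := by
  induction w with
  | nil => intro d hd; simp [permWordMap] at hd
  | cons x w ih =>
    by_cases hx : π x = x
    · have e : permWordMap π (x :: w) = x :: permWordMap π w := by simp [permWordMap, hx]
      intro d hd
      rw [e] at hd ⊢
      cases d with
      | zero => simp at hd
      | succ d =>
        simp only [List.getElem?_cons_succ] at hd
        obtain ⟨h1, h2⟩ := ih d hd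
        refine ⟨fun c hc => ?_, fun c hc => ?_⟩
        · cases c with
          | zero => simp
          | succ c => simpa using h1 c (by omega)
        · cases c with
          | succ c => simpa using h2 c (by omega)
          | zero =>
            rcases getElem?_permWordMap π w d with h | ⟨y, hy, hy'⟩
            · exact absurd h.symm hd
            · rw [hy, hy'] at hd
              have hyx : π y ≠ y := fun e => hd (by rw [e])
              simp only [List.getElem?_cons_zero, List.getElem?_cons_succ, hy, hy', ne_eq,
                Option.some.injEq]
              refine ⟨fun e => hyx (e ▸ hx), fun e => hyx ?_⟩
              rw [← π.injective (hx.trans e)]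
              exact hx
    · have e : permWordMap π (x :: w) = π x :: w := by simp [permWordMap, hx]
      intro d hd
      rw [e] at hd ⊢
      cases d with
      | succ d => simp at hd
      | zero =>
        refine ⟨fun c hc => ?_, fun c hc => by omega⟩
        cases c with
        | zero => exact absurd rfl hc
        | succ c => simp

/-! ### Distances in the Schreier graphs -/

theorem length_hanoiGroup_smul {k : ℕ} (g : hanoiGroup k) (w : List (Fin k)) :
    (g • w).length = w.length := by
  obtain ⟨g, hg⟩ := g
  change (g • w).length = w.length
  induction hg using Subgroup.closure_induction generalizing w with
  | mem g hg =>
    obtain ⟨i, j, -, rfl⟩ := hg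
    exact length_permWordMap _ _
  | one => rw [one_smul]
  | mul a b _ _ iha ihb => rw [mul_smul, iha, ihb]
  | inv a _ ih =>
    rw [← ih (a⁻¹ • w), smul_inv_smul]

theorem permAut_swap_mem {k : ℕ} {i j : Fin k} (hij : i ≠ j) :
    permAut (Equiv.swap i j) ∈ hanoiGenerators k := by
  rcases lt_or_gt_of_ne hij with h | h
  · exact ⟨i, j, h, rfl⟩
  · exact ⟨j, i, h, by rw [Equiv.swap_comm]⟩

/-- The move between the pegs `i` and `j` as an element of the Hanoi Towers group. -/
def hanoiSwap {k : ℕ} {i j : Fin k} (hij : i ≠ j) : hanoiGroup k :=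
  ⟨permAut (Equiv.swap i j), Subgroup.subset_closure (permAut_swap_mem hij)⟩

theorem hanoiSwap_smul {k : ℕ} {i j : Fin k} (hij : i ≠ j) (w : List (Fin k)) :
    hanoiSwap hij • w = permWordMap (Equiv.swap i j) w := rfl

theorem HanoiReach.exists_smul_eq {k : ℕ} {Q : Finset (Fin k)} {L : ℕ} {u v : List (Fin k)}
    (h : HanoiReach Q L u v) : ∃ g : hanoiGroup k, g • u = v := by
  induction h with
  | refl L u => exact ⟨1, one_smul _ _⟩
  | tail i j hi hj hij _ ih =>
    obtain ⟨g, hg⟩ := ih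
    exact ⟨hanoiSwap hij * g, by rw [mul_smul, hg, hanoiSwap_smul]⟩

section schreier

open MulAction

variable {k : ℕ} {ξ : ℕ → Fin k} {n : ℕ}

theorem edist_le_of_hanoiReach {Q : Finset (Fin k)} {L : ℕ} {u v : List (Fin k)}
    (h : HanoiReach Q L u v) : ∀ x y : hanoiGroup k ⧸ hanoiStabilizer ξ n,
      ofQuotientStabilizer (hanoiGroup k) (rayPrefix ξ n) x = u →
      ofQuotientStabilizer (hanoiGroup k) (rayPrefix ξ n) y = v →
      (hanoiSchreierGraph ξ n).edist x y ≤ L := by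
  induction h with
  | refl L u =>
    intro x y hx hy
    obtain rfl := injective_ofQuotientStabilizer _ _ (hx.trans hy.symm)
    simp
  | @tail L u v i j hi hj hij _ ih =>
    intro x y hx hy
    set y' : hanoiGroup k ⧸ hanoiStabilizer ξ n := (hanoiSwap hij)⁻¹ • y with hy'
    have e : hanoiSwap hij • y' = y := smul_inv_smul _ _
    have h1 := ih x y' hx (by
      have := ofQuotientStabilizer_smul (hanoiGroup k) (rayPrefix ξ n) (hanoiSwap hij)⁻¹ y
      refine this.trans ?_
      rw [hy, ← hanoiSwap_smul hij, inv_smul_smul])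
    have h2 : (hanoiSchreierGraph ξ n).edist y' y ≤ 1 := by
      rw [SimpleGraph.edist_le_one_iff_adj_or_eq]
      by_cases hne : y' = y
      · exact Or.inr hne
      · exact Or.inl ((SimpleGraph.fromRel_adj _ _ _).2
          ⟨hne, Or.inl ⟨hanoiSwap hij, permAut_swap_mem hij, e⟩⟩)
    push_cast
    exact SimpleGraph.edist_triangle.trans (add_le_add h1 h2)

theorem hanoiReach_of_walk {x y : hanoiGroup k ⧸ hanoiStabilizer ξ n}
    (p : (hanoiSchreierGraph ξ n).Walk x y) : HanoiReach Finset.univ p.length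
      (ofQuotientStabilizer (hanoiGroup k) (rayPrefix ξ n) x)
      (ofQuotientStabilizer (hanoiGroup k) (rayPrefix ξ n) y) := by
  induction p with
  | nil => exact .refl _ _
  | @cons x z y hadj p ih =>
    have key : ∀ a b : hanoiGroup k ⧸ hanoiStabilizer ξ n,
        (∃ s ∈ {s : hanoiGroup k | (s : TreeAut k) ∈ hanoiGenerators k}, s • a = b) →
        HanoiReach Finset.univ 1 (ofQuotientStabilizer (hanoiGroup k) (rayPrefix ξ n) a)
          (ofQuotientStabilizer (hanoiGroup k) (rayPrefix ξ n) b) := by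
      rintro a b ⟨s, ⟨i, j, hij, hs⟩, rfl⟩
      have hs' : s = hanoiSwap hij.ne := Subtype.ext hs
      have := HanoiReach.tail i j (Finset.mem_univ _) (Finset.mem_univ _) hij.ne
        (.refl 0 (ofQuotientStabilizer (hanoiGroup k) (rayPrefix ξ n) a))
      rw [← hanoiSwap_smul hij.ne, ← hs', zero_add,
        ← ofQuotientStabilizer_smul (hanoiGroup k) (rayPrefix ξ n) s a] at this
      exact this
    have h1 := ((SimpleGraph.fromRel_adj _ _ _).1 hadj).2.elim (key x z) fun h => (key z x h).symm
    exact (h1.trans ih).mono (by rw [SimpleGraph.Walk.length_cons, add_comm])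

/-- The diameter of the graph of configurations of `n` disks on `k` pegs. -/
noncomputable def hanoiDiam (k n : ℕ) : ℕ :=
  sInf {L | ∀ u v : List (Fin k), u.length = n → v.length = n → HanoiReach Finset.univ L u v}

theorem length_rayPrefix : (rayPrefix ξ n).length = n := by simp [rayPrefix]

theorem length_ofQuotientStabilizer (x : hanoiGroup k ⧸ hanoiStabilizer ξ n) :
    (ofQuotientStabilizer (hanoiGroup k) (rayPrefix ξ n) x).length = n := by
  obtain ⟨g, rfl⟩ := QuotientGroup.mk_surjective x
  exact (length_hanoiGroup_smul g _).trans length_rayPrefix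

/-- Connectedness makes the action on level `n` transitive, so the orbit map identifies cosets with
words of length `n`, and walks with sequences of moves. -/
theorem ediam_hanoiSchreierGraph (ξ : ℕ → Fin k) (h : ∃ L, ∀ u v : List (Fin k), u.length = n →
    v.length = n → HanoiReach Finset.univ L u v) :
    (hanoiSchreierGraph ξ n).ediam = (hanoiDiam k n : ℕ∞) := by
  have hd : ∀ u v : List (Fin k), u.length = n → v.length = n →
    HanoiReach Finset.univ (hanoiDiam k n) u v := Nat.sInf_mem h
  have hle : (hanoiSchreierGraph ξ n).ediam ≤ (hanoiDiam k n : ℕ∞) :=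
    SimpleGraph.ediam_le_of_edist_le fun x y => edist_le_of_hanoiReach
      (hd _ _ (length_ofQuotientStabilizer x) (length_ofQuotientStabilizer y)) x y rfl rfl
  refine le_antisymm hle ?_
  obtain ⟨m, hm⟩ := ENat.ne_top_iff_exists.1 (ne_top_of_le_ne_top (ENat.natCast_ne_top _) hle)
  rw [← hm, Nat.cast_le]
  refine Nat.sInf_le fun u v hu hv => ?_
  have surj : ∀ w : List (Fin k), w.length = n → ∃ x : hanoiGroup k ⧸ hanoiStabilizer ξ n,
      ofQuotientStabilizer (hanoiGroup k) (rayPrefix ξ n) x = w := fun w hw => by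
    obtain ⟨g, hg⟩ := (hd _ w length_rayPrefix hw).exists_smul_eq
    exact ⟨QuotientGroup.mk g, hg⟩
  obtain ⟨x, rfl⟩ := surj u hu
  obtain ⟨y, rfl⟩ := surj v hv
  have hxy : (hanoiSchreierGraph ξ n).edist x y ≤ m := hm ▸ SimpleGraph.edist_le_ediam
  obtain ⟨p, hp⟩ := SimpleGraph.exists_walk_of_edist_ne_top
    (ne_top_of_le_ne_top (ENat.natCast_ne_top _) hxy)
  rw [← hp, Nat.cast_le] at hxy
  exact (hanoiReach_of_walk p).mono hxy

end schreier

/-! ### Explicit bounds on the diameter -/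

theorem pow_le_factorial_mul_multichoose (j s : ℕ) :
    j ^ s ≤ s.factorial * Nat.multichoose j s := by
  rw [Nat.multichoose_eq, ← Nat.ascFactorial_eq_factorial_mul_choose']
  exact Nat.pow_succ_le_ascFactorial j s

theorem agreeOutside_univ {k : ℕ} {u v : List (Fin k)} (h : u.length = v.length) :
    AgreeOutside Finset.univ u v :=
  List.forall₂_iff_get.2 ⟨h, fun _ _ _ => Or.inr ⟨Finset.mem_univ _, Finset.mem_univ _⟩⟩

theorem le_multichoose_of_le_pow {s n N : ℕ} (hs : 1 ≤ s) (h : n ≤ N ^ s) :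
    n ≤ Nat.multichoose (s.factorial * N) s := by
  have h1 := pow_le_factorial_mul_multichoose (s.factorial * N) s
  have h2 : s.factorial * n ≤ (s.factorial * N) ^ s := by
    rw [mul_pow]
    exact Nat.mul_le_mul (Nat.le_self_pow (by omega) _) h
  exact Nat.le_of_mul_le_mul_left (h2.trans h1) (Nat.factorial_pos s)

theorem hanoiReach_univ {s n N : ℕ} (hs : 1 ≤ s) (h : n ≤ N ^ s) (u v : List (Fin (s + 2)))
    (hu : u.length = n) (hv : v.length = n) :
    HanoiReach Finset.univ (8 ^ (s.factorial * N + s + 1)) u v :=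
  hanoiReach_of_length_le s _ _ (by simp) u v (hu ▸ le_multichoose_of_le_pow hs h)
    (agreeOutside_univ (hu.trans hv.symm))

theorem hanoiDiam_le {s n N : ℕ} (hs : 1 ≤ s) (h : n ≤ N ^ s) :
    hanoiDiam (s + 2) n ≤ 8 ^ (s.factorial * N + s + 1) :=
  Nat.sInf_le (hanoiReach_univ hs h)

theorem exists_hanoiReach_univ {s : ℕ} (hs : 1 ≤ s) (n : ℕ) : ∃ L, ∀ u v : List (Fin (s + 2)),
    u.length = n → v.length = n → HanoiReach Finset.univ L u v :=
  ⟨_, hanoiReach_univ hs (Nat.le_self_pow (by omega) n)⟩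

theorem two_pow_le_hanoiDiam {s n j : ℕ} (hs : 1 ≤ s) (h : 2 ^ (s + 1) * (j + 1) ^ s ≤ n) :
    2 ^ j ≤ hanoiDiam (s + 2) n := by
  have hd : ∀ u v : List (Fin (s + 2)), u.length = n → v.length = n →
    HanoiReach Finset.univ (hanoiDiam (s + 2) n) u v := Nat.sInf_mem (exists_hanoiReach_univ hs n)
  -- Every disk must go from peg 0 to peg 1, so all of them move.
  obtain ⟨f, h0, hL, hf⟩ := (hd (List.replicate n 0) (List.replicate n 1) (by simp)
    (by simp)).exists_seq
  have hlen : ∀ t, (f t).length = n := by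
    intro t
    induction t with
    | zero => simp [h0]
    | succ t ih =>
      rcases hf t with e | ⟨π, e⟩
      · rw [e, ih]
      · rw [e, length_permWordMap, ih]
  have := add_two_pow_le_of_moves (c := fun t d => (f t)[d]?) (fun t => by
      rcases hf t with e | ⟨π, e⟩
      · rw [e]; exact fun d hd => absurd rfl hd
      · rw [e]; exact hanoiStep_permWordMap π (f t))
    s j (Finset.univ.map Function.Embedding.some) (Finset.range n) 0 (hanoiDiam (s + 2) n)
    (by simp) (fun d hd t _ _ => by
      rw [Finset.mem_range] at hd
      simp [List.getElem?_eq_getElem (show d < (f t).length by rw [hlen]; exact hd)])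
    (fun d hd => by
      rw [Finset.mem_range] at hd
      by_contra hm
      have := eq_of_not_moves hm (Nat.zero_le _) le_rfl
      simp [h0, hL, hd] at this)
    (by simpa using h)
  omega

/-! ### Comparison of growth -/

theorem natCast_le_rpow_inv_ceil_pow {s : ℕ} (hs : 1 ≤ s) (n : ℕ) :
    n ≤ ⌈(n : ℝ) ^ (1 / (s : ℝ))⌉₊ ^ s := by
  have h : (n : ℝ) ≤ (⌈(n : ℝ) ^ (1 / (s : ℝ))⌉₊ : ℝ) ^ s := by
    calc (n : ℝ) = ((n : ℝ) ^ (1 / (s : ℝ))) ^ s := by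
          rw [one_div, Real.rpow_inv_natCast_pow (Nat.cast_nonneg n) (by omega)]
      _ ≤ _ := pow_le_pow_left₀ (by positivity) (Nat.le_ceil _) _
  exact_mod_cast h

theorem natCast_ceil_rpow_le {n : ℕ} (hn : 1 ≤ n) {α : ℝ} (hα : 0 ≤ α) :
    (⌈(n : ℝ) ^ α⌉₊ : ℝ) ≤ 2 * (n : ℝ) ^ α := by
  have h1 : 1 ≤ (n : ℝ) ^ α := Real.one_le_rpow (by exact_mod_cast hn) hα
  linarith [Nat.ceil_lt_add_one (show (0 : ℝ) ≤ (n : ℝ) ^ α by linarith)]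

theorem rpow_pow_mul_natCast {s : ℕ} (hs : 1 ≤ s) (K n : ℕ) :
    ((K ^ s * n : ℕ) : ℝ) ^ (1 / (s : ℝ)) = K * (n : ℝ) ^ (1 / (s : ℝ)) := by
  push_cast
  rw [Real.mul_rpow (by positivity) (by positivity), one_div,
    Real.pow_rpow_inv_natCast (Nat.cast_nonneg K) (by omega)]

theorem growthLE_hanoiDiam_exp {s : ℕ} (hs : 1 ≤ s) :
    GrowthLE (fun n => (hanoiDiam (s + 2) n : ℝ)) fun n => Real.exp ((n : ℝ) ^ (1 / (s : ℝ))) := by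
  set K := 3 * (2 * s.factorial + s + 1) with hK
  refine ⟨K ^ s, by positivity, fun n hn => ?_⟩
  set x := (n : ℝ) ^ (1 / (s : ℝ)) with hx
  have hx1 : 1 ≤ x := Real.one_le_rpow (by exact_mod_cast hn) (by positivity)
  have hN : (⌈x⌉₊ : ℝ) ≤ 2 * x := natCast_ceil_rpow_le hn (by positivity)
  have h1 : (hanoiDiam (s + 2) n : ℝ) ≤ 8 ^ (s.factorial * ⌈x⌉₊ + s + 1) := by
    exact_mod_cast hanoiDiam_le hs (natCast_le_rpow_inv_ceil_pow hs n)
  have h8 : (8 : ℝ) ≤ Real.exp 3 := by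
    have h : Real.exp 3 = Real.exp 1 ^ 3 := by rw [← Real.exp_nat_mul]; norm_num
    rw [h]
    calc (8 : ℝ) = 2 ^ 3 := by norm_num
      _ ≤ _ := pow_le_pow_left₀ (by norm_num) (by linarith [Real.exp_one_gt_d9]) 3
  dsimp only
  rw [rpow_pow_mul_natCast hs]
  refine h1.trans ((pow_le_pow_left₀ (by norm_num) h8 _).trans ?_)
  rw [← Real.exp_nat_mul, Real.exp_le_exp, hK]
  push_cast
  have hf : (s.factorial : ℝ) * ⌈x⌉₊ ≤ s.factorial * (2 * x) :=
    mul_le_mul_of_nonneg_left hN (Nat.cast_nonneg _)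
  have hs' : (s + 1 : ℝ) * 1 ≤ (s + 1) * x := mul_le_mul_of_nonneg_left hx1 (by positivity)
  rw [← hx]
  linarith

theorem growthLE_exp_hanoiDiam {s : ℕ} (hs : 1 ≤ s) :
    GrowthLE (fun n => Real.exp ((n : ℝ) ^ (1 / (s : ℝ)))) fun n => (hanoiDiam (s + 2) n : ℝ) := by
  -- Taking `j = 2 * ⌈x⌉₊` gives `4 ^ ⌈x⌉₊ ≥ exp x`; the 5 comes from `2 * ⌈x⌉₊ + 1 ≤ 4 * x + 1 ≤ 5
  -- * x`.
  refine ⟨2 ^ (s + 1) * 5 ^ s, by positivity, fun n hn => ?_⟩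
  set x := (n : ℝ) ^ (1 / (s : ℝ)) with hx
  have hx1 : 1 ≤ x := Real.one_le_rpow (by exact_mod_cast hn) (by positivity)
  have hN : (⌈x⌉₊ : ℝ) ≤ 2 * x := natCast_ceil_rpow_le hn (by positivity)
  have hpow : (2 * ⌈x⌉₊ + 1) ^ s ≤ 5 ^ s * n := by
    have h : ((2 * ⌈x⌉₊ + 1 : ℝ)) ^ s ≤ 5 ^ s * n := by
      calc (2 * ⌈x⌉₊ + 1 : ℝ) ^ s ≤ (5 * x) ^ s :=
            pow_le_pow_left₀ (by positivity) (by linarith) _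
        _ = 5 ^ s * n := by
            rw [mul_pow, hx, one_div, Real.rpow_inv_natCast_pow (Nat.cast_nonneg n) (by omega)]
    exact_mod_cast h
  have h1 : (2 : ℝ) ^ (2 * ⌈x⌉₊) ≤ hanoiDiam (s + 2) (2 ^ (s + 1) * 5 ^ s * n) := by
    exact_mod_cast two_pow_le_hanoiDiam hs (by rw [mul_assoc]; gcongr)
  refine le_trans ?_ h1
  rw [pow_mul]
  calc Real.exp x ≤ Real.exp ⌈x⌉₊ := Real.exp_le_exp.2 (Nat.le_ceil x)
    _ = Real.exp 1 ^ ⌈x⌉₊ := by rw [← Real.exp_nat_mul, mul_one]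
    _ ≤ _ := pow_le_pow_left₀ (Real.exp_pos _).le (by linarith [Real.exp_one_lt_d9]) _

theorem tendsto_root_of_growthLE_exp {f : ℕ → ℝ} {α : ℝ} (hα1 : α < 1)
    (hf : GrowthLE f fun n => Real.exp ((n : ℝ) ^ α)) (h1 : ∀ᶠ n in Filter.atTop, 1 ≤ f n) :
    Filter.Tendsto (fun n : ℕ => f n ^ (1 / (n : ℝ))) Filter.atTop (nhds 1) := by
  obtain ⟨C, hC, hle⟩ := hf
  have hlim : Filter.Tendsto (fun n : ℕ => Real.exp ((C : ℝ) ^ α * (n : ℝ) ^ (-(1 - α))))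
      Filter.atTop (nhds 1) := by
    have := ((tendsto_rpow_neg_atTop (show 0 < 1 - α by linarith)).comp
      (tendsto_natCast_atTop_atTop (R := ℝ))).const_mul ((C : ℝ) ^ α)
    rw [mul_zero] at this
    simpa [Function.comp_def] using (Real.continuous_exp.tendsto 0).comp this
  refine tendsto_of_tendsto_of_tendsto_of_le_of_le' tendsto_const_nhds hlim ?_ ?_
  · filter_upwards [h1] with n hn
    exact Real.one_le_rpow hn (by positivity)
  · filter_upwards [h1, Filter.eventually_ge_atTop 1] with n hn hn1
    have hn0 : (0 : ℝ) < n := by exact_mod_cast hn1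
    calc f n ^ (1 / (n : ℝ)) ≤ Real.exp (((C * n : ℕ) : ℝ) ^ α) ^ (1 / (n : ℝ)) :=
          Real.rpow_le_rpow (by linarith) (hle n hn1) (by positivity)
      _ = Real.exp ((C : ℝ) ^ α * (n : ℝ) ^ (-(1 - α))) := by
          rw [← Real.exp_mul, Nat.cast_mul, Real.mul_rpow (by positivity) hn0.le, neg_sub,
            Real.rpow_sub_one hn0.ne']
          congr 1
          ring

/-- Since `n ^ m = exp (m * log n)` and `log n ≤ n ^ α / α`, rescaling by `K` with `K ^ α ≥ m / α`
suffices. -/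
theorem growthLE_rpow_of_growthLE_exp {f : ℕ → ℝ} {α : ℝ} (hα : 0 < α)
    (hf : GrowthLE (fun n => Real.exp ((n : ℝ) ^ α)) f) (m : ℝ) (hm : 0 < m) :
    GrowthLE (fun n : ℕ => (n : ℝ) ^ m) f := by
  obtain ⟨C, hC, hle⟩ := hf
  obtain ⟨K, hK⟩ := exists_nat_ge (max 1 ((m / α) ^ (1 / α)))
  have hK1 : (1 : ℝ) ≤ K := (le_max_left _ _).trans hK
  have hKα : m / α ≤ (K : ℝ) ^ α := by
    calc m / α = ((m / α) ^ (1 / α)) ^ α := by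
          rw [one_div, Real.rpow_inv_rpow (by positivity) hα.ne']
      _ ≤ (K : ℝ) ^ α :=
          Real.rpow_le_rpow (by positivity) ((le_max_right _ _).trans hK) hα.le
  have hKpos : 0 < K := by exact_mod_cast lt_of_lt_of_le one_pos hK1
  refine ⟨C * K, by positivity, fun n hn => ?_⟩
  have hn0 : (0 : ℝ) < n := by exact_mod_cast hn
  rw [mul_assoc]
  refine le_trans ?_ (hle (K * n) (Nat.mul_pos hKpos hn))
  dsimp only
  rw [Nat.cast_mul, Real.mul_rpow (by positivity) hn0.le, Real.rpow_def_of_pos hn0,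
    Real.exp_le_exp]
  have hlog : Real.log n ≤ (n : ℝ) ^ α / α := Real.log_le_rpow_div hn0.le hα
  calc Real.log n * m ≤ (n : ℝ) ^ α / α * m := mul_le_mul_of_nonneg_right hlog hm.le
    _ = m / α * (n : ℝ) ^ α := by ring
    _ ≤ _ := mul_le_mul_of_nonneg_right hKα (by positivity)

theorem mainTheorem3 (k : ℕ) (hk : 3 ≤ k) :
    ∃ d : ℕ → ℕ,
      (∀ (ξ : ℕ → Fin k) (n : ℕ), (hanoiSchreierGraph ξ n).ediam = (d n : ℕ∞)) ∧
      GrowthEquiv (fun n => (d n : ℝ))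
        (fun n => Real.exp ((n : ℝ) ^ (1 / ((k : ℝ) - 2)))) ∧
      (4 ≤ k → IntermediateGrowth (fun n => (d n : ℝ))) := by
  obtain ⟨s, rfl⟩ : ∃ s, k = s + 2 := ⟨k - 2, by omega⟩
  have hs : 1 ≤ s := by omega
  have e : ((s + 2 : ℕ) : ℝ) - 2 = s := by push_cast; ring
  rw [e]
  refine ⟨hanoiDiam (s + 2), fun ξ n => ediam_hanoiSchreierGraph ξ (exists_hanoiReach_univ hs n),
    ⟨growthLE_hanoiDiam_exp hs, growthLE_exp_hanoiDiam hs⟩, fun h4 => ⟨?_, ?_⟩⟩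
  -- Here `4 ≤ k` is needed: the exponent `1 / s` must be below 1.
  · have hs2 : (1 : ℝ) < s := by exact_mod_cast (show 1 < s by omega)
    refine tendsto_root_of_growthLE_exp ?_ (growthLE_hanoiDiam_exp hs) ?_
    · rw [div_lt_one (by linarith)]
      exact hs2
    · filter_upwards [Filter.eventually_ge_atTop (2 ^ (s + 1))] with n hn
      exact_mod_cast two_pow_le_hanoiDiam (j := 0) hs (by simpa using hn)
  · exact growthLE_rpow_of_growthLE_exp (by positivity) (growthLE_exp_hanoiDiam hs)
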